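/- Setting. For a metric space $X$, the doubling constant is the least $N$ such that every closed ball of radius $r>0$ is covered by $N$ closed balls of radius $r/2$; $X$ is doubling if $N<\infty$, and its doubling dimension is $\log_2 N$. For $q\ge 1$ and $L\ge\lambda>0$, a (measurable) function $f:X\to\mathbb R$ is nondegenerate with parameters $(\lambda,L,q)$ if it has a unique minimizer $x^*$ and $\lambda\,\mathcal D(x,x^*)^q\le f(x)-f(x^*)\le L\,\mathcal D(x,x^*)^q$ for all $x\in X$. A nondegenerate bandit instance with these parameters consists of such an $f$ and of a noise law that is mean-zero and $1$-sub-Gaussian; playing $x_t$ at step $t$ produces the loss $y_t=f(x_t)+\xi_t$ with $\xi_t$ i.i.d. from the noise law. A policy $\pi$ for $T$ steps with at most $M$ rounds of communication (possibly randomized) chooses communication points $0=t_0\le t_1\le\dots\le t_M=T$; the point $t_{j}$ and the choices $x_t$, $t_{j-1}<t\le t_{j}$, may depend only on the losses $y_1,\dots,y_{t_{j-1}}$ and on internal randomness independent of the noise. Its regret is $R^\pi(T)=\sum_{t=1}^T (f(x_t)-f(x^*))$. Corollary. There are absolute constants $A_->1$ and $c>0$ such that for every $q\ge1$ there are $L\ge\lambda>0$,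 depending only on $q$, for which the following holds. For every real $d\ge 1$ there is a compact doubling metric space $(X_0,\mathcal D_0)$ of doubling dimension $\lfloor d\rfloor$ (the same space for all $T$) on which no policy with fewer than $c\log\log T$ rounds of communication achieves an expected regret of order $A_-^{\lfloor d\rfloor}\sqrt T$ over all nondegenerate instances with parameters $(\lambda,L,q)$. Precisely: for every $C>0$ there is $T_0$, depending only on $C$ and $q$ (not on $d$), such that for all $T\ge T_0$, all $M<c\log\log T$ and every policy $\pi$ for $T$ steps with at most $M$ rounds of communication there is a nondegenerate instance on $X_0$ with parameters $(\lambda,L,q)$ on which $\mathbb E[R^\pi(T)]> C\,A_-^{\lfloor d\rfloor}\sqrt T$. -/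

import Mathlib

open MeasureTheory ProbabilityTheory

namespace BatchedBandit

/-- Every closed ball of radius `r > 0` of `X` can be covered by `N` closed balls
of radius `r / 2`. -/
def CoversByHalves (X : Type) [MetricSpace X] (N : ℕ) : Prop :=
  ∀ (x : X) (r : ℝ), 0 < r → ∃ s : Finset X, s.card ≤ N ∧
    Metric.closedBall x r ⊆ ⋃ z ∈ s, Metric.closedBall z (r / 2)

/-- A metric space is doubling if it has a finite doubling constant. -/
def IsDoubling (X : Type) [MetricSpace X] : Prop :=
  ∃ N : ℕ, CoversByHalves X N

/-- The doubling constant (meaningful on doubling spaces). -/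
noncomputable def doublingConstant (X : Type) [MetricSpace X] : ℕ :=
  sInf {N : ℕ | CoversByHalves X N}

/-- The doubling dimension `log₂ N`, where `N` is the doubling constant. -/
noncomputable def doublingDim (X : Type) [MetricSpace X] : ℝ :=
  Real.logb 2 (doublingConstant X)

/-- `f` is nondegenerate with parameters `lam ≤ L` and `q`, and `xs` is its unique minimizer. -/
def IsNondegenerate {X : Type} [MetricSpace X] (lam L q : ℝ) (f : X → ℝ) (xs : X) : Prop :=
  0 < lam ∧ lam ≤ L ∧ 1 ≤ q ∧
    (∀ x, x ≠ xs → f xs < f x) ∧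
    ∀ x, lam * dist x xs ^ q ≤ f x - f xs ∧ f x - f xs ≤ L * dist x xs ^ q

/-- A nondegenerate bandit instance: a nondegenerate mean loss function with its minimizer,
and the common law of the i.i.d. noise, which is centred and `1`-sub-Gaussian. -/
structure Instance (X : Type) [MetricSpace X] [MeasurableSpace X] (lam L q : ℝ) where
  loss : X → ℝ
  opt : X
  nondegenerate : IsNondegenerate lam L q loss opt
  measurable_loss : Measurable loss
  noise : Measure ℝ
  isProbabilityMeasure_noise : IsProbabilityMeasure noise
  noise_mean : ∫ z, z ∂noise = 0
  noise_subgaussian : HasSubgaussianMGF (fun z : ℝ => z) 1 noise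

/-- A (possibly randomized) policy for a `T`-step game with at most `M` rounds of communication,
whose communication points are chosen adaptively.

Steps are numbered `0, …, T - 1`. The policy draws a seed `u` once, independently of the noise.
`grid j u y` is the communication point `t_j`, and `arm t u y` is the point played at step `t`,
when the seed is `u` and the loss sequence is `y`. The losses of the steps `s < t_j` are revealed
at time `t_j`: the next communication point `t_{j+1}` and the choices in the batch
`t_j ≤ t < t_{j+1}` may depend on the seed and on these losses only. (The earlier choices are
themselves functions of the seed and of the revealed losses.) -/
structure Policy (X : Type) [MeasurableSpace X] (T M : ℕ) where
  Seed : Type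
  measurableSpaceSeed : MeasurableSpace Seed
  seedLaw : Measure Seed
  isProbabilityMeasure_seedLaw : IsProbabilityMeasure seedLaw
  grid : ℕ → Seed → (ℕ → ℝ) → ℕ
  arm : ℕ → Seed → (ℕ → ℝ) → X
  measurable_grid : ∀ j, Measurable fun p : Seed × (ℕ → ℝ) => grid j p.1 p.2
  measurable_arm : ∀ t, Measurable fun p : Seed × (ℕ → ℝ) => arm t p.1 p.2
  grid_zero : ∀ u y, grid 0 u y = 0
  grid_mono : ∀ j, j < M → ∀ u y, grid j u y ≤ grid (j + 1) u y
  grid_last : ∀ u y, grid M u y = T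
  grid_adapted : ∀ j, j < M → ∀ u y y', (∀ s, s < grid j u y → y s = y' s) →
    grid (j + 1) u y = grid (j + 1) u y'
  arm_adapted : ∀ j, j < M → ∀ t u y y', grid j u y ≤ t → t < grid (j + 1) u y →
    (∀ s, s < grid j u y → y s = y' s) → arm t u y = arm t u y'

attribute [instance] Policy.measurableSpaceSeed

/-- The losses of the steps before `t` when `π` is run with seed `u` on the mean loss `f` and the
noise sequence `ξ` (entries from index `t` on are `0`): the loss of step `t` is `f (x_t) + ξ_t`. -/
def Policy.losses {X : Type} [MeasurableSpace X] {T M : ℕ} (π : Policy X T M) (f : X → ℝ)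
    (u : π.Seed) (ξ : ℕ → ℝ) : ℕ → ℕ → ℝ
  | 0 => fun _ => 0
  | t + 1 => Function.update (π.losses f u ξ t) t (f (π.arm t u (π.losses f u ξ t)) + ξ t)

/-- The point played at step `t`. -/
def Policy.choice {X : Type} [MeasurableSpace X] {T M : ℕ} (π : Policy X T M) (f : X → ℝ)
    (u : π.Seed) (ξ : ℕ → ℝ) (t : ℕ) : X :=
  π.arm t u (π.losses f u ξ t)

/-- The expected `T`-step regret of `π` on the instance `I`: the seed and the i.i.d. noise
variables are independent. -/
noncomputable def Policy.expectedRegret {X : Type} [MetricSpace X] [MeasurableSpace X] {T M : ℕ}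
    {lam L q : ℝ} (π : Policy X T M) (I : Instance X lam L q) : ℝ :=
  ∫ p : π.Seed × (ℕ → ℝ),
    ∑ t ∈ Finset.range T, (I.loss (π.choice I.loss p.1 p.2 t) - I.loss I.opt)
    ∂(π.seedLaw.prod (Measure.infinitePi fun _ : ℕ => I.noise))

end BatchedBandit

/-! Test the policy against deterministic times `θ j = w j ^ 2` with `θ M = T`. As `θ 0 > 0` and the
last communication point is `T`, in every run some batch starts by `θ j` and lasts until `θ (j +
1)`. Hence one index `j` works with probability at least `1 / M` under the base loss `dist x o ^ q`
(`exists_longBatch_prob`). In such a run all steps before `θ (j + 1)` use only the first `θ j`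
losses.

Dig a deeper minimum at a point `z` with `dist z o ^ q` of order `1 / w j`. The first `w j ^ 2`
losses barely distinguish the two functions under Gaussian noise, yet no point is good for both. So
`two_point_bound` forces regret of order `θ (j + 1) / (w j * M ^ 2)` on one of them; `M` is squared
because the change of measure is a Cauchy–Schwarz bound.

Choosing `θ (j + 1) = B * √T * w j` makes this `B * √T / M ^ 2` for every `j`, and `B` of order `C *
M ^ 2 * 2 ^ n` suffices. The recursion pushes the coarsest scale up doubly exponentially, and `z`
fits in a cube of side `s` once `B ^ 2 ^ M ≤ √T * s ^ q`. Few rounds give `2 ^ M ≤ √(log T)`, and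
the side `s = exp (n ^ 2)` absorbs the factor `2 ^ n` in `B`, so the threshold for `T` is
independent of the dimension `n`. Enlarging a sup-norm cube leaves its doubling constant at `2 ^ n`.
-/

namespace BatchedBandit

/-! ### Gaussian change of measure. -/

open scoped ENNReal NNReal

/-- The Cauchy–Schwarz inequality for lower Lebesgue integrals. -/
lemma sq_lintegral_mul_le {α : Type*} [MeasurableSpace α] (μ : Measure α) {f g : α → ℝ≥0∞}
    (hf : AEMeasurable f μ) (hg : AEMeasurable g μ) :
    (∫⁻ a, f a * g a ∂μ) ^ 2 ≤ (∫⁻ a, f a ^ 2 ∂μ) * ∫⁻ a, g a ^ 2 ∂μ := by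
  have h := ENNReal.lintegral_mul_le_Lp_mul_Lq μ Real.HolderConjugate.two_two hf hg
  simp only [Pi.mul_apply, ENNReal.rpow_two] at h
  have hsq : ∀ x : ℝ≥0∞, (x ^ (1 / 2 : ℝ)) ^ 2 = x := fun x => by
    rw [← ENNReal.rpow_two, ← ENNReal.rpow_mul]; norm_num
  calc (∫⁻ a, f a * g a ∂μ) ^ 2
      ≤ ((∫⁻ a, f a ^ 2 ∂μ) ^ (1 / 2 : ℝ) * (∫⁻ a, g a ^ 2 ∂μ) ^ (1 / 2 : ℝ)) ^ 2 := by
        gcongr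
    _ = _ := by rw [mul_pow, hsq, hsq]

lemma sq_lintegral_le_of_isProbabilityMeasure {α : Type*} [MeasurableSpace α] (μ : Measure α)
    [IsProbabilityMeasure μ] {f : α → ℝ≥0∞} (hf : AEMeasurable f μ) :
    (∫⁻ a, f a ∂μ) ^ 2 ≤ ∫⁻ a, f a ^ 2 ∂μ := by
  simpa using sq_lintegral_mul_le μ hf (g := fun _ => 1) aemeasurable_const

/-- Completing the square. Divided by the density at `b` and integrated, it gives the second moment
`exp ((a - b) ^ 2)` of the likelihood ratio. -/
lemma gaussianPDF_mul_gaussianPDF (a b x : ℝ) :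
    gaussianPDF a 1 x * gaussianPDF a 1 x =
      ENNReal.ofReal (Real.exp ((a - b) ^ 2)) * gaussianPDF (2 * a - b) 1 x *
        gaussianPDF b 1 x := by
  simp only [gaussianPDF, gaussianPDFReal]
  rw [← ENNReal.ofReal_mul (by positivity), ← ENNReal.ofReal_mul (by positivity),
    ← ENNReal.ofReal_mul (by positivity)]
  congr 1
  have h : Real.exp (-(x - a) ^ 2 / (2 * (1 : ℝ≥0))) * Real.exp (-(x - a) ^ 2 / (2 * (1 : ℝ≥0)))
      = Real.exp ((a - b) ^ 2) * Real.exp (-(x - (2 * a - b)) ^ 2 / (2 * (1 : ℝ≥0))) *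
        Real.exp (-(x - b) ^ 2 / (2 * (1 : ℝ≥0))) := by
    rw [← Real.exp_add, ← Real.exp_add, ← Real.exp_add]
    congr 1
    simp only [NNReal.coe_one]
    ring
  linear_combination (√(2 * Real.pi * (1 : ℝ≥0)))⁻¹ ^ 2 * h

/-- Change of measure between two unit Gaussian laws. -/
lemma sq_lintegral_gaussianReal_le (a b : ℝ) {g : ℝ → ℝ≥0∞} (hg : Measurable g) :
    (∫⁻ z, g z ∂gaussianReal a 1) ^ 2 ≤
      ENNReal.ofReal (Real.exp ((a - b) ^ 2)) * ∫⁻ z, g z ^ 2 ∂gaussianReal b 1 := by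
  have hm : ∀ m : ℝ, Measurable (gaussianPDF m 1) := fun m => measurable_gaussianPDF m 1
  have hd : ∀ (m : ℝ) (h : ℝ → ℝ≥0∞), Measurable h →
      ∫⁻ z, h z ∂gaussianReal m 1 = ∫⁻ z, gaussianPDF m 1 z * h z := fun m h hh => by
    rw [gaussianReal_of_var_ne_zero _ one_ne_zero,
      lintegral_withDensity_eq_lintegral_mul _ (hm m) hh]
    rfl
  set φ : ℝ → ℝ≥0∞ := gaussianPDF b 1 with hφ
  have hpos : ∀ z, φ z ≠ 0 := fun z => (gaussianPDF_pos b one_ne_zero z).ne'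
  have htop : ∀ z, φ z ≠ ∞ := fun z => by simp [hφ, gaussianPDF]
  have hkey : ∀ z, (gaussianPDF a 1 z / φ z) ^ 2 * φ z =
      ENNReal.ofReal (Real.exp ((a - b) ^ 2)) * gaussianPDF (2 * a - b) 1 z := fun z => by
    have h := gaussianPDF_mul_gaussianPDF a b z
    rw [sq, ENNReal.div_eq_inv_mul]
    calc (φ z)⁻¹ * gaussianPDF a 1 z * ((φ z)⁻¹ * gaussianPDF a 1 z) * φ z
        = (φ z)⁻¹ * (gaussianPDF a 1 z * gaussianPDF a 1 z) * ((φ z)⁻¹ * φ z) := by ring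
      _ = (φ z)⁻¹ * (gaussianPDF a 1 z * gaussianPDF a 1 z) := by
        rw [ENNReal.inv_mul_cancel (hpos z) (htop z), mul_one]
      _ = (ENNReal.ofReal (Real.exp ((a - b) ^ 2)) * gaussianPDF (2 * a - b) 1 z) *
          ((φ z)⁻¹ * φ z) := by rw [h]; ring
      _ = _ := by rw [ENNReal.inv_mul_cancel (hpos z) (htop z), mul_one]
  have hr : Measurable fun z => gaussianPDF a 1 z / φ z := (hm a).div (hm b)
  have h1 : ∫⁻ z, g z ∂gaussianReal a 1 =
      ∫⁻ z, (gaussianPDF a 1 z / φ z) * g z ∂gaussianReal b 1 := by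
    rw [hd a g hg, hd b (fun z => gaussianPDF a 1 z / φ z * g z) (hr.mul hg)]
    refine lintegral_congr fun z => ?_
    change _ = φ z * _
    rw [← mul_assoc, ENNReal.mul_div_cancel (hpos z) (htop z)]
  have h2 : ∫⁻ z, (gaussianPDF a 1 z / φ z) ^ 2 ∂gaussianReal b 1 =
      ENNReal.ofReal (Real.exp ((a - b) ^ 2)) := by
    rw [hd b _ (hr.pow_const 2)]
    calc ∫⁻ z, φ z * (gaussianPDF a 1 z / φ z) ^ 2
        = ∫⁻ z, ENNReal.ofReal (Real.exp ((a - b) ^ 2)) * gaussianPDF (2 * a - b) 1 z :=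
          lintegral_congr fun z => by rw [mul_comm, hkey]
      _ = _ := by
        rw [lintegral_const_mul _ (hm _), lintegral_gaussianPDF_eq_one _ one_ne_zero, mul_one]
  rw [h1, ← h2]
  exact sq_lintegral_mul_le _ hr.aemeasurable hg.aemeasurable

lemma lintegral_gaussianReal_add (m : ℝ) {g : ℝ → ℝ≥0∞} (hg : Measurable g) :
    ∫⁻ z, g (m + z) ∂gaussianReal 0 1 = ∫⁻ z, g z ∂gaussianReal m 1 := by
  have h := gaussianReal_map_const_add (μ := 0) (v := 1) m
  rw [zero_add] at h
  rw [← h, lintegral_map hg (by fun_prop)]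

lemma sq_lintegral_gaussianReal_shift_le (a b : ℝ) {g : ℝ → ℝ≥0∞} (hg : Measurable g) :
    (∫⁻ z, g (a + z) ∂gaussianReal 0 1) ^ 2 ≤
      ENNReal.ofReal (Real.exp ((a - b) ^ 2)) * ∫⁻ z, g (b + z) ^ 2 ∂gaussianReal 0 1 := by
  rw [lintegral_gaussianReal_add a hg, lintegral_gaussianReal_add b (hg.pow_const 2)]
  exact sq_lintegral_gaussianReal_le a b hg

lemma measurable_update_prod (t : ℕ) :
    Measurable fun p : (ℕ → ℝ) × ℝ => Function.update p.1 t p.2 := by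
  refine measurable_pi_lambda _ fun i => ?_
  by_cases h : i = t
  · subst h; simpa using measurable_snd
  · simp only [Function.update_of_ne h]
    exact (measurable_pi_apply i).comp measurable_fst

/-- Resampling one coordinate of an i.i.d. sequence does not change its law. -/
lemma infinitePi_prod_map_update (ν : Measure ℝ) [IsProbabilityMeasure ν] (t : ℕ) :
    ((Measure.infinitePi fun _ : ℕ => ν).prod ν).map (fun p => Function.update p.1 t p.2) =
      Measure.infinitePi fun _ : ℕ => ν := by
  refine Measure.eq_infinitePi _ fun s A hA => ?_
  classical
  rw [Measure.map_apply (measurable_update_prod t) (MeasurableSet.pi s.countable_toSet fun i _ => hA i)]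
  by_cases ht : t ∈ s
  · have : (fun p : (ℕ → ℝ) × ℝ => Function.update p.1 t p.2) ⁻¹' (Set.pi s A) =
        (Set.pi (s.erase t : Finset ℕ) A) ×ˢ A t := by
      ext ⟨x, z⟩
      simp only [Set.mem_preimage, Set.mem_pi, Set.mem_prod, Finset.mem_coe, Finset.mem_erase]
      constructor
      · intro h
        refine ⟨fun i hi => ?_, by simpa using h t ht⟩
        simpa [Function.update_of_ne hi.1] using h i hi.2
      · rintro ⟨h1, h2⟩ i hi
        by_cases h : i = t
        · subst h; simpa using h2
        · simpa [Function.update_of_ne h] using h1 i ⟨h, hi⟩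
    rw [this, Measure.prod_prod, Measure.infinitePi_pi _ (fun i _ => hA i),
      Finset.prod_erase_mul _ _ ht]
  · have : (fun p : (ℕ → ℝ) × ℝ => Function.update p.1 t p.2) ⁻¹' (Set.pi s A) =
        (Set.pi s A) ×ˢ Set.univ := by
      ext ⟨x, z⟩
      simp only [Set.mem_preimage, Set.mem_pi, Set.mem_prod, Finset.mem_coe, Set.mem_univ,
        and_true]
      refine forall₂_congr fun i hi => ?_
      rw [Function.update_of_ne (ne_of_mem_of_not_mem hi ht)]
    rw [this, Measure.prod_prod, Measure.infinitePi_pi _ (fun i _ => hA i), measure_univ, mul_one]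

/-! ### Change of measure along a run of a policy. -/

section Run

variable {X : Type} [MeasurableSpace X] {T M : ℕ} (π : Policy X T M)

/-- Causality: past losses ignore present and future noise, so the noise of the current step can be
resampled. -/
lemma Policy.losses_update (f : X → ℝ) (u : π.Seed) (ξ : ℕ → ℝ) {t s : ℕ} (h : t ≤ s) (z : ℝ) :
    π.losses f u (Function.update ξ s z) t = π.losses f u ξ t := by
  induction t with
  | zero => rfl
  | succ t ih =>
    simp only [Policy.losses]
    rw [ih (by omega), Function.update_of_ne (by omega)]

lemma Policy.losses_apply (f : X → ℝ) (u : π.Seed) (ξ : ℕ → ℝ) {t t' s : ℕ} (hst : s < t)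
    (htt' : t ≤ t') : π.losses f u ξ t' s = π.losses f u ξ t s := by
  induction t', htt' using Nat.le_induction with
  | base => rfl
  | succ n hn ih =>
    rw [← ih]
    simp only [Policy.losses]
    rw [Function.update_of_ne (by omega)]

lemma Policy.measurable_losses {f : X → ℝ} (hf : Measurable f) (t : ℕ) :
    Measurable fun p : π.Seed × (ℕ → ℝ) => π.losses f p.1 p.2 t := by
  induction t with
  | zero => exact measurable_const
  | succ t ih =>
    simp only [Policy.losses]
    refine (measurable_update_prod t).comp (ih.prodMk ?_)
    refine Measurable.add (hf.comp ?_) ((measurable_pi_apply t).comp measurable_snd)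
    exact (π.measurable_arm t).comp (measurable_fst.prodMk ih)

lemma Policy.measurable_choice {f : X → ℝ} (hf : Measurable f) (t : ℕ) :
    Measurable fun p : π.Seed × (ℕ → ℝ) => π.choice f p.1 p.2 t :=
  (π.measurable_arm t).comp (measurable_fst.prodMk (π.measurable_losses hf t))

instance : IsProbabilityMeasure π.seedLaw := π.isProbabilityMeasure_seedLaw

/-- The law of the seed and of standard Gaussian noise. -/
noncomputable abbrev Policy.gaussianLaw : Measure (π.Seed × (ℕ → ℝ)) :=
  π.seedLaw.prod (Measure.infinitePi fun _ : ℕ => gaussianReal 0 1)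

/-- Conditioning on the losses before step `t`. -/
lemma Policy.lintegral_losses_succ {f : X → ℝ} (hf : Measurable f) (t : ℕ)
    {g : π.Seed × (ℕ → ℝ) → ℝ≥0∞} (hg : Measurable g) :
    ∫⁻ p, g (p.1, π.losses f p.1 p.2 (t + 1)) ∂π.gaussianLaw =
      ∫⁻ p, (fun w : π.Seed × (ℕ → ℝ) => ∫⁻ z, g (w.1, Function.update w.2 t
        (f (π.arm t w.1 w.2) + z)) ∂gaussianReal 0 1) (p.1, π.losses f p.1 p.2 t)
        ∂π.gaussianLaw := by
  have hL : Measurable fun p : π.Seed × (ℕ → ℝ) => g (p.1, π.losses f p.1 p.2 (t + 1)) :=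
    hg.comp (measurable_fst.prodMk (π.measurable_losses hf (t + 1)))
  have hR : Measurable fun p : (π.Seed × (ℕ → ℝ)) × ℝ =>
      g (p.1.1, Function.update (π.losses f p.1.1 p.1.2 t) t
        (f (π.arm t p.1.1 (π.losses f p.1.1 p.1.2 t)) + p.2)) := by
    refine hg.comp ((measurable_fst.comp measurable_fst).prodMk
      ((measurable_update_prod t).comp (((π.measurable_losses hf t).comp measurable_fst).prodMk ?_)))
    exact ((hf.comp (π.measurable_choice hf t)).comp measurable_fst).add measurable_snd
  rw [lintegral_prod _ hL.aemeasurable, lintegral_prod _ hR.lintegral_prod_right'.aemeasurable]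
  refine lintegral_congr fun u => ?_
  have hLu : Measurable fun ξ : ℕ → ℝ => g (u, π.losses f u ξ (t + 1)) :=
    hL.comp measurable_prodMk_left
  conv_lhs => rw [← infinitePi_prod_map_update (gaussianReal 0 1) t]
  rw [lintegral_map hLu (measurable_update_prod t),
    lintegral_prod (fun p : (ℕ → ℝ) × ℝ => g (u, π.losses f u (Function.update p.1 t p.2) (t + 1)))
      (hLu.comp (measurable_update_prod t)).aemeasurable]
  refine lintegral_congr fun ξ => lintegral_congr fun z => ?_
  simp only [Policy.losses]
  rw [π.losses_update f u ξ le_rfl, Function.update_self]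

/-- Change of measure between two mean loss functions at distance at most `δ`, for the losses of
the first `t` steps. -/
lemma Policy.sq_lintegral_losses_le {f₀ f₁ : X → ℝ} (hf₀ : Measurable f₀) (hf₁ : Measurable f₁)
    {δ : ℝ} (hδ : ∀ x, |f₀ x - f₁ x| ≤ δ) (t : ℕ) {g : π.Seed × (ℕ → ℝ) → ℝ≥0∞}
    (hg : Measurable g) :
    (∫⁻ p, g (p.1, π.losses f₀ p.1 p.2 t) ∂π.gaussianLaw) ^ 2 ≤
      ENNReal.ofReal (Real.exp (t * δ ^ 2)) *
        ∫⁻ p, g (p.1, π.losses f₁ p.1 p.2 t) ^ 2 ∂π.gaussianLaw := by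
  induction t generalizing g with
  | zero =>
    simp only [Policy.losses, Nat.cast_zero, zero_mul, Real.exp_zero, ENNReal.ofReal_one, one_mul]
    exact sq_lintegral_le_of_isProbabilityMeasure _
      (hg.comp (measurable_fst.prodMk measurable_const)).aemeasurable
  | succ t ih =>
    have hmeas : ∀ (f : X → ℝ), Measurable f → ∀ g : π.Seed × (ℕ → ℝ) → ℝ≥0∞, Measurable g →
        Measurable fun w : π.Seed × (ℕ → ℝ) => ∫⁻ z, g (w.1, Function.update w.2 t
        (f (π.arm t w.1 w.2) + z)) ∂gaussianReal 0 1 := by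
      intro f hf g hg
      refine Measurable.lintegral_prod_right' (f := fun p : (π.Seed × (ℕ → ℝ)) × ℝ =>
        g (p.1.1, Function.update p.1.2 t (f (π.arm t p.1.1 p.1.2) + p.2))) ?_
      refine hg.comp ((measurable_fst.comp measurable_fst).prodMk
        ((measurable_update_prod t).comp ((measurable_snd.comp measurable_fst).prodMk ?_)))
      exact ((hf.comp (π.measurable_arm t)).comp measurable_fst).add measurable_snd
    rw [π.lintegral_losses_succ hf₀ t hg, π.lintegral_losses_succ hf₁ t (hg.pow_const 2)]
    refine (ih (hmeas f₀ hf₀ g hg)).trans ?_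
    -- With the past `w` fixed, both runs play the same point, so the next losses are unit Gaussians
    -- with means at most `δ` apart.
    have hstep : ∀ w : π.Seed × (ℕ → ℝ),
        (∫⁻ z, g (w.1, Function.update w.2 t (f₀ (π.arm t w.1 w.2) + z)) ∂gaussianReal 0 1) ^ 2 ≤
        ENNReal.ofReal (Real.exp (δ ^ 2)) * ∫⁻ z, g (w.1, Function.update w.2 t
          (f₁ (π.arm t w.1 w.2) + z)) ^ 2 ∂gaussianReal 0 1 := by
      intro w
      refine (sq_lintegral_gaussianReal_shift_le (f₀ (π.arm t w.1 w.2)) (f₁ (π.arm t w.1 w.2))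
        (g := fun z => g (w.1, Function.update w.2 t z)) ?_).trans ?_
      · exact hg.comp (measurable_const.prodMk (measurable_update w.2))
      · exact mul_le_mul' (ENNReal.ofReal_le_ofReal (Real.exp_le_exp.2
          (sq_le_sq' (neg_le_of_abs_le (hδ _)) (le_of_abs_le (hδ _))))) le_rfl
    calc ENNReal.ofReal (Real.exp (t * δ ^ 2)) * _
        ≤ ENNReal.ofReal (Real.exp (t * δ ^ 2)) * ∫⁻ p,
          ENNReal.ofReal (Real.exp (δ ^ 2)) * (fun w : π.Seed × (ℕ → ℝ) =>
            ∫⁻ z, g (w.1, Function.update w.2 t (f₁ (π.arm t w.1 w.2) + z)) ^ 2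
              ∂gaussianReal 0 1) (p.1, π.losses f₁ p.1 p.2 t) ∂π.gaussianLaw := by
          gcongr with p
          exact hstep _
      _ = _ := by
        rw [lintegral_const_mul, ← mul_assoc, ← ENNReal.ofReal_mul (by positivity),
          ← Real.exp_add]
        · congr 3
          push_cast; ring
        · exact (hmeas f₁ hf₁ _ (hg.pow_const 2)).comp
            (measurable_fst.prodMk (π.measurable_losses hf₁ t))

/-- Change of measure for events determined by the seed and the first `t` losses. -/
lemma Policy.sq_measure_losses_le {f₀ f₁ : X → ℝ} (hf₀ : Measurable f₀) (hf₁ : Measurable f₁)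
    {δ : ℝ} (hδ : ∀ x, |f₀ x - f₁ x| ≤ δ) (t : ℕ) {E : Set (π.Seed × (ℕ → ℝ))}
    (hE : MeasurableSet E) :
    π.gaussianLaw.real {p | (p.1, π.losses f₀ p.1 p.2 t) ∈ E} ^ 2 ≤
      Real.exp (t * δ ^ 2) * π.gaussianLaw.real {p | (p.1, π.losses f₁ p.1 p.2 t) ∈ E} := by
  have key : ∀ f : X → ℝ, Measurable f →
      ∫⁻ p, E.indicator (fun _ => (1 : ℝ≥0∞)) (p.1, π.losses f p.1 p.2 t) ∂π.gaussianLaw =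
      π.gaussianLaw {p | (p.1, π.losses f p.1 p.2 t) ∈ E} := fun f hf => by
    exact lintegral_indicator_one ((measurable_fst.prodMk (π.measurable_losses hf t)) hE)
  have h := π.sq_lintegral_losses_le hf₀ hf₁ hδ t
    (g := E.indicator fun _ => (1 : ℝ≥0∞)) (measurable_const.indicator hE)
  have hsq : ∀ w, E.indicator (fun _ => (1 : ℝ≥0∞)) w ^ 2 = E.indicator (fun _ => 1) w := by
    intro w; by_cases hw : w ∈ E <;> simp [hw]
  simp only [hsq] at h
  rw [key f₀ hf₀, key f₁ hf₁] at h
  have := ENNReal.toReal_mono (by finiteness) h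
  rwa [ENNReal.toReal_pow, ENNReal.toReal_mul, ENNReal.toReal_ofReal (by positivity)] at this

end Run

end BatchedBandit

namespace BatchedBandit

/-! ### Adaptive batches against a deterministic time grid. -/

section Grid

variable {X : Type} [MeasurableSpace X] {T M : ℕ} (π : Policy X T M)

lemma Policy.grid_le_grid (u : π.Seed) (y : ℕ → ℝ) {i j : ℕ} (hij : i ≤ j) (hj : j ≤ M) :
    π.grid i u y ≤ π.grid j u y := by
  induction j, hij using Nat.le_induction with
  | base => exact le_rfl
  | succ n hn ih => exact (ih (by omega)).trans (π.grid_mono n (by omega) u y)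

/-- The losses before the `j`-th communication already fix the next one. Hence whether a batch is
long can be decided from the losses up to the time by which it starts. -/
lemma Policy.grid_congr (u : π.Seed) {y y' : ℕ → ℝ} {j : ℕ} (hj : j < M)
    (h : ∀ s, s < π.grid j u y → y s = y' s) {k : ℕ} (hk : k ≤ j + 1) :
    π.grid k u y = π.grid k u y' := by
  cases k with
  | zero => rw [π.grid_zero, π.grid_zero]
  | succ k =>
    exact π.grid_adapted k (by omega) u y y' fun s hs =>
      h s (hs.trans_le (π.grid_le_grid u y (by omega) hj.le))

lemma Policy.exists_grid_le_lt (u : π.Seed) (y : ℕ → ℝ) {t j : ℕ} (h : t < π.grid j u y) :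
    ∃ k < j, π.grid k u y ≤ t ∧ t < π.grid (k + 1) u y := by
  induction j with
  | zero => rw [π.grid_zero] at h; omega
  | succ j ih =>
    rcases lt_or_ge t (π.grid j u y) with h' | h'
    · obtain ⟨k, hk, hk'⟩ := ih h'
      exact ⟨k, by omega, hk'⟩
    · exact ⟨j, by omega, h', h⟩

/-- The event that the `j`-th communication happens by time `a`, and the next one not before `b`. -/
def Policy.longBatch (j a b : ℕ) : Set (π.Seed × (ℕ → ℝ)) :=
  {w | π.grid j w.1 w.2 ≤ a ∧ b ≤ π.grid (j + 1) w.1 w.2}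

lemma Policy.measurableSet_longBatch (j a b : ℕ) : MeasurableSet (π.longBatch j a b) :=
  (measurableSet_le (π.measurable_grid j) measurable_const).inter
    (measurableSet_le measurable_const (π.measurable_grid (j + 1)))

/-- During a long batch starting by time `a`, the choices only depend on the first `a` losses. -/
lemma Policy.choice_eq_arm (f : X → ℝ) (u : π.Seed) (ξ : ℕ → ℝ) {j a b t : ℕ} (hj : j < M)
    (h : (u, π.losses f u ξ a) ∈ π.longBatch j a b) (ht : t < b) :
    π.choice f u ξ t = π.arm t u (π.losses f u ξ a) := by
  -- Step `t` may lie in batch `j` or an earlier one; either way its batch starts by time `a`.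
  obtain ⟨k, hk, hkt, htk⟩ := π.exists_grid_le_lt u (π.losses f u ξ a) (ht.trans_le h.2)
  refine (π.arm_adapted k (by omega) t u _ _ hkt htk fun s hs => ?_).symm
  have hka : π.grid k u (π.losses f u ξ a) ≤ a :=
    (π.grid_le_grid u _ (by omega) (by omega)).trans h.1
  rcases le_total t a with hta | hta
  · exact π.losses_apply f u ξ (hs.trans_le hkt) hta
  · exact (π.losses_apply f u ξ (hs.trans_le hka) hta).symm

/-- Some batch is long relative to any grid `θ` of deterministic times. -/
lemma Policy.exists_longBatch (f : X → ℝ) (u : π.Seed) (ξ : ℕ → ℝ) {θ : ℕ → ℝ}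
    (h0 : 0 < θ 0) (hM : θ M = T) (hT : ∀ j ≤ M, θ j ≤ T) :
    ∃ j < M, (u, π.losses f u ξ ⌊θ j⌋₊) ∈ π.longBatch j ⌊θ j⌋₊ ⌈θ (j + 1)⌉₊ := by
  classical
  set Y := π.losses f u ξ T
  -- Take the first `i` at which the policy's grid has caught up with `θ`. It is not `0`, and batch
  -- `i - 1` is long.
  have hex : ∃ i, θ i ≤ π.grid i u Y := ⟨M, by rw [hM, π.grid_last]⟩
  obtain ⟨hi, hmin⟩ := And.intro (Nat.find_spec hex) (fun m => Nat.find_min (H := hex) (m := m))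
  have hle : Nat.find hex ≤ M := Nat.find_min' hex (by rw [hM, π.grid_last])
  generalize Nat.find hex = i at hi hmin hle
  obtain _ | j := i
  · rw [π.grid_zero] at hi
    exact absurd hi (by simpa using h0)
  have hj := hmin j (by omega)
  rw [not_le] at hj
  have hfl : π.grid j u Y ≤ ⌊θ j⌋₊ := Nat.le_floor hj.le
  have hflT : ⌊θ j⌋₊ ≤ T := Nat.floor_le_of_le (hT j (by omega))
  have hagree : ∀ s, s < π.grid j u Y → Y s = π.losses f u ξ ⌊θ j⌋₊ s := fun s hs =>
    π.losses_apply f u ξ (hs.trans_le hfl) hflT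
  refine ⟨j, by omega, ?_, ?_⟩
  · rw [← π.grid_congr u (by omega) hagree (Nat.le_succ j)]; exact hfl
  · rw [← π.grid_congr u (by omega) hagree le_rfl]; exact Nat.ceil_le.2 hi

/-- One of the `M` batches is long with probability at least `1 / M`. -/
lemma Policy.exists_longBatch_prob {f : X → ℝ} {θ : ℕ → ℝ}
    (h0 : 0 < θ 0) (hM : θ M = T) (hT : ∀ j ≤ M, θ j ≤ T) :
    ∃ j < M, 1 / (M : ℝ) ≤ π.gaussianLaw.real {p : π.Seed × (ℕ → ℝ) |
      (p.1, π.losses f p.1 p.2 ⌊θ j⌋₊) ∈ π.longBatch j ⌊θ j⌋₊ ⌈θ (j + 1)⌉₊} := by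
  by_contra! hcon
  have huniv : (Set.univ : Set (π.Seed × (ℕ → ℝ))) ⊆ ⋃ j ∈ Finset.range M, {p |
      (p.1, π.losses f p.1 p.2 ⌊θ j⌋₊) ∈ π.longBatch j ⌊θ j⌋₊ ⌈θ (j + 1)⌉₊} := by
    rintro ⟨u, ξ⟩ -
    obtain ⟨j, hj, h⟩ := π.exists_longBatch f u ξ h0 hM hT
    simp only [Set.mem_iUnion, Finset.mem_range]
    exact ⟨j, hj, h⟩
  have h1 : (1 : ℝ) ≤ ∑ j ∈ Finset.range M, π.gaussianLaw.real {p : π.Seed × (ℕ → ℝ) |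
      (p.1, π.losses f p.1 p.2 ⌊θ j⌋₊) ∈ π.longBatch j ⌊θ j⌋₊ ⌈θ (j + 1)⌉₊} :=
    calc (1 : ℝ) = π.gaussianLaw.real Set.univ := by simp
      _ ≤ _ := measureReal_mono huniv (measure_ne_top _ _)
      _ ≤ _ := measureReal_biUnion_finset_le _ _
  rcases Nat.eq_zero_or_pos M with rfl | hpos
  · simp at h1; linarith
  · have h2 := Finset.sum_lt_sum_of_nonempty (Finset.nonempty_range_iff.2 hpos.ne')
      (fun j hj => hcon j (Finset.mem_range.1 hj))
    rw [Finset.sum_const, Finset.card_range, nsmul_eq_mul,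
      mul_one_div_cancel (by positivity)] at h2
    linarith

end Grid

/-! ### The two-point lower bound on regret. -/

section Regret

variable {X : Type} [MetricSpace X] [MeasurableSpace X] {T M : ℕ} {lam L q : ℝ}

lemma Instance.regret_nonneg (I : Instance X lam L q) (x : X) : 0 ≤ I.loss x - I.loss I.opt :=
  (mul_nonneg I.nondegenerate.1.le (by positivity)).trans (I.nondegenerate.2.2.2.2 x).1

lemma Instance.exists_regret_le [CompactSpace X] (I : Instance X lam L q) :
    ∃ B, ∀ x, I.loss x - I.loss I.opt ≤ B := by
  obtain ⟨hlam, hL, hq, -, h⟩ := I.nondegenerate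
  have hL0 : 0 ≤ L := hlam.le.trans hL
  refine ⟨L * Metric.diam (Set.univ : Set X) ^ q, fun x => (h x).2.trans ?_⟩
  gcongr
  exact Metric.dist_le_diam_of_mem isCompact_univ.isBounded (Set.mem_univ _) (Set.mem_univ _)

variable [CompactSpace X] (π : Policy X T M)

/-- Markov's inequality for the regret. -/
lemma Policy.mul_measure_le_expectedRegret (I : Instance X lam L q)
    (hI : I.noise = gaussianReal 0 1) {b : ℝ} (hb : 0 ≤ b) {S : Set (π.Seed × (ℕ → ℝ))}
    (hS : ∀ p ∈ S, b ≤ ∑ t ∈ Finset.range T, (I.loss (π.choice I.loss p.1 p.2 t) - I.loss I.opt)) :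
    b * π.gaussianLaw.real S ≤ π.expectedRegret I := by
  have heq : π.expectedRegret I = ∫ p, ∑ t ∈ Finset.range T,
      (I.loss (π.choice I.loss p.1 p.2 t) - I.loss I.opt) ∂π.gaussianLaw := by
    simp only [Policy.expectedRegret, hI]
  obtain ⟨B, hB⟩ := I.exists_regret_le
  have hnn := fun p : π.Seed × (ℕ → ℝ) => Finset.sum_nonneg fun t (_ : t ∈ Finset.range T) =>
    I.regret_nonneg (π.choice I.loss p.1 p.2 t)
  have hint : Integrable (fun p : π.Seed × (ℕ → ℝ) => ∑ t ∈ Finset.range T,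
      (I.loss (π.choice I.loss p.1 p.2 t) - I.loss I.opt)) π.gaussianLaw := by
    refine integrable_finsetSum _ fun t _ => Integrable.of_bound (C := B) ?_ ?_
    · exact ((I.measurable_loss.comp (π.measurable_choice I.measurable_loss t)).sub_const
        _).aestronglyMeasurable
    · refine Filter.Eventually.of_forall fun p => ?_
      rw [Real.norm_eq_abs, abs_of_nonneg (I.regret_nonneg _)]
      exact hB _
  rw [heq]
  refine le_trans ?_ (mul_meas_ge_le_integral_of_nonneg (Filter.Eventually.of_forall hnn) hint b)
  exact mul_le_mul_of_nonneg_left (measureReal_mono hS) hb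

/-- The two-point bound: if two instances with nearby losses have no common good point, then a
policy with a batch that is long with probability at least `p` has large regret on one of them. -/
lemma Policy.two_point_bound (I₀ I₁ : Instance X lam L q) (h₀ : I₀.noise = gaussianReal 0 1)
    (h₁ : I₁.noise = gaussianReal 0 1) {δ g p : ℝ} (hg : 0 ≤ g) (hp : 0 ≤ p)
    (hδ : ∀ x, |I₀.loss x - I₁.loss x| ≤ δ)
    (hsep : ∀ x, g ≤ (I₀.loss x - I₀.loss I₀.opt) + (I₁.loss x - I₁.loss I₁.opt))
    {j a b : ℕ} (hj : j < M) (hb : b ≤ T)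
    (hlong : p ≤ π.gaussianLaw.real {w : π.Seed × (ℕ → ℝ) |
      (w.1, π.losses I₀.loss w.1 w.2 a) ∈ π.longBatch j a b}) :
    ∃ I : Instance X lam L q,
      b * g / 2 * ((p / 2) ^ 2 * Real.exp (-(a * δ ^ 2))) ≤ π.expectedRegret I := by
  have hp1 : p ≤ 1 := hlong.trans measureReal_le_one
  have hG : 0 ≤ b * g / 2 := by positivity
  have hexp : Real.exp (-(a * δ ^ 2)) ≤ 1 := Real.exp_le_one_iff.2 (by simp; positivity)
  set A := π.longBatch j a b
  have hA : MeasurableSet A := π.measurableSet_longBatch j a b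
  -- The event that the planned choices are bad for `I₀`. Evaluated at the first `a` losses it needs
  -- no later data, so `A \ H` can be moved from `I₀` to `I₁`.
  set H : Set (π.Seed × (ℕ → ℝ)) := {w | b * g / 2 ≤
    ∑ t ∈ Finset.range b, (I₀.loss (π.arm t w.1 w.2) - I₀.loss I₀.opt)} with hH
  have hHm : MeasurableSet H := by
    refine measurableSet_le measurable_const (Finset.measurable_sum _ fun t _ => ?_)
    exact (I₀.measurable_loss.comp (π.measurable_arm t)).sub_const _
  have hsum : ∀ (I : Instance X lam L q) (w : π.Seed × (ℕ → ℝ)),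
      (w.1, π.losses I.loss w.1 w.2 a) ∈ A →
      ∑ t ∈ Finset.range b,
        (I.loss (π.arm t w.1 (π.losses I.loss w.1 w.2 a)) - I.loss I.opt) ≤
      ∑ t ∈ Finset.range T, (I.loss (π.choice I.loss w.1 w.2 t) - I.loss I.opt) := by
    intro I w hw
    refine le_trans (le_of_eq (Finset.sum_congr rfl fun t ht => ?_))
      (Finset.sum_le_sum_of_subset_of_nonneg (Finset.range_mono hb)
        fun t _ _ => I.regret_nonneg _)
    rw [π.choice_eq_arm I.loss w.1 w.2 hj hw (Finset.mem_range.1 ht)]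
  -- Either the long batch is often bad for `I₀`, or it is often good for `I₀`. In the second case
  -- it remains so with probability of order `p ^ 2` under `I₁`, where `hsep` makes it bad.
  by_cases hcase : p / 2 ≤ π.gaussianLaw.real {w : π.Seed × (ℕ → ℝ) |
      (w.1, π.losses I₀.loss w.1 w.2 a) ∈ A ∩ H}
  · refine ⟨I₀, le_trans ?_ (π.mul_measure_le_expectedRegret I₀ h₀ hG
      (S := {w | (w.1, π.losses I₀.loss w.1 w.2 a) ∈ A ∩ H})
      (fun w hw => hw.2.trans (hsum I₀ w hw.1)))⟩
    refine mul_le_mul_of_nonneg_left (le_trans ?_ hcase) hG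
    have : (p / 2) ^ 2 ≤ p / 2 := by nlinarith
    exact (mul_le_of_le_one_right (by positivity) hexp).trans this
  · have hdiff : p / 2 ≤ π.gaussianLaw.real {w : π.Seed × (ℕ → ℝ) |
        (w.1, π.losses I₀.loss w.1 w.2 a) ∈ A \ H} := by
      have hle : π.gaussianLaw.real {w : π.Seed × (ℕ → ℝ) |
          (w.1, π.losses I₀.loss w.1 w.2 a) ∈ A} ≤ _ :=
        (measureReal_mono (fun w hw => by
          by_cases hw' : (w.1, π.losses I₀.loss w.1 w.2 a) ∈ H
          · exact Or.inl ⟨hw, hw'⟩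
          · exact Or.inr ⟨hw, hw'⟩)).trans (measureReal_union_le
        {w : π.Seed × (ℕ → ℝ) | (w.1, π.losses I₀.loss w.1 w.2 a) ∈ A ∩ H}
        {w : π.Seed × (ℕ → ℝ) | (w.1, π.losses I₀.loss w.1 w.2 a) ∈ A \ H})
      linarith [not_le.1 hcase]
    have hcm := π.sq_measure_losses_le I₀.measurable_loss I₁.measurable_loss hδ a (hA.diff hHm)
    refine ⟨I₁, le_trans ?_ (π.mul_measure_le_expectedRegret I₁ h₁ hG
      (S := {w | (w.1, π.losses I₁.loss w.1 w.2 a) ∈ A \ H})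
      (fun w hw => le_trans ?_ (hsum I₁ w hw.1)))⟩
    · refine mul_le_mul_of_nonneg_left ?_ hG
      rw [Real.exp_neg, ← div_eq_mul_inv, div_le_iff₀ (Real.exp_pos _), mul_comm]
      exact le_trans (by gcongr) hcm
    · have hlt : ∑ t ∈ Finset.range b,
          (I₀.loss (π.arm t w.1 (π.losses I₁.loss w.1 w.2 a)) - I₀.loss I₀.opt) < b * g / 2 :=
        lt_of_not_ge hw.2
      have hall : (b : ℝ) * g ≤ ∑ t ∈ Finset.range b,
          ((I₀.loss (π.arm t w.1 (π.losses I₁.loss w.1 w.2 a)) - I₀.loss I₀.opt) +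
          (I₁.loss (π.arm t w.1 (π.losses I₁.loss w.1 w.2 a)) - I₁.loss I₁.opt)) := by
        simpa using Finset.card_nsmul_le_sum (Finset.range b) _ g fun t _ => hsep _
      rw [Finset.sum_add_distrib] at hall
      linarith

end Regret

end BatchedBandit

namespace BatchedBandit

/-! ### The doubling dimension of the sup-norm cube. -/

section Cube

/-- Use the `2 ^ n` centres with coordinates `x i ± r / 2`, clamped to the cube. Clamping is
1-Lipschitz and fixes the points of the cube. -/
lemma coversByHalves_cube (n : ℕ) {s : ℝ} (hs : 0 ≤ s) :
    CoversByHalves (Fin n → Set.Icc (0 : ℝ) s) (2 ^ n) := by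
  classical
  intro x r hr
  let c : (Fin n → Bool) → (Fin n → Set.Icc (0 : ℝ) s) := fun b i =>
    Set.projIcc 0 s hs (if b i then (x i : ℝ) + r / 2 else (x i : ℝ) - r / 2)
  refine ⟨Finset.univ.image c, Finset.card_image_le.trans (by simp), fun y hy => ?_⟩
  rw [Metric.mem_closedBall, dist_pi_le_iff hr.le] at hy
  simp only [Set.mem_iUnion]
  refine ⟨c fun i => decide ((x i : ℝ) ≤ y i), Finset.mem_image_of_mem _ (Finset.mem_univ _), ?_⟩
  rw [Metric.mem_closedBall, dist_pi_le_iff (by positivity)]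
  intro i
  have hi := hy i
  have hproj : ∀ v : ℝ, dist (y i) (Set.projIcc 0 s hs v) ≤ |(y i : ℝ) - v| := fun v => by
    have hy' : Set.projIcc 0 s hs (y i) = y i := Set.projIcc_val hs (y i)
    rw [← hy', Subtype.dist_eq, Real.dist_eq]
    rw [hy']
    simpa [hy'] using Set.abs_projIcc_sub_projIcc hs (c := (y i : ℝ)) (d := v)
  rw [Subtype.dist_eq, Real.dist_eq, abs_le] at hi
  refine (hproj _).trans ?_
  by_cases h : (x i : ℝ) ≤ y i
  · simp only [h, decide_true, if_true]
    rw [abs_le]; constructor <;> linarith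
  · simp only [h, decide_false, Bool.false_eq_true, if_false]
    rw [abs_le]; constructor <;> linarith

/-- The cube is a ball of radius `s / 2` about its midpoint. Its `2 ^ n` corners are pairwise `s`
apart, so a ball of radius `s / 4` holds at most one. -/
lemma two_pow_le_of_coversByHalves_cube {n N : ℕ} {s : ℝ} (hs : 0 < s)
    (h : CoversByHalves (Fin n → Set.Icc (0 : ℝ) s) N) : 2 ^ n ≤ N := by
  classical
  let mid : Set.Icc (0 : ℝ) s := ⟨s / 2, by constructor <;> linarith⟩
  let v : Bool → Set.Icc (0 : ℝ) s := fun b => if b then ⟨s, by constructor <;> linarith⟩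
    else ⟨0, by constructor <;> linarith⟩
  have hv : ∀ b, dist (v b) mid ≤ s / 2 := by
    intro b
    cases b <;> simp only [v, mid, Subtype.dist_eq, Real.dist_eq, abs_le] <;>
      constructor <;> norm_num <;> linarith
  have hv' : ∀ b b', b ≠ b' → dist (v b) (v b') = s := by
    intro b b' hbb
    cases b <;> cases b' <;>
      simp_all [v, Subtype.dist_eq, Real.dist_eq, abs_of_pos]
  obtain ⟨t, ht, hcov⟩ := h (fun _ => mid) (s / 2) (by linarith)
  have hex : ∀ b : Fin n → Bool, ∃ z ∈ t, dist (fun i => v (b i)) z ≤ s / 2 / 2 := by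
    intro b
    have hb : (fun i => v (b i)) ∈ Metric.closedBall (fun _ : Fin n => mid) (s / 2) := by
      rw [Metric.mem_closedBall, dist_pi_le_iff (by linarith)]
      exact fun i => hv _
    simpa using hcov hb
  choose z hzt hz using hex
  refine le_trans ?_ ht
  have hcard : (Finset.univ : Finset (Fin n → Bool)).card ≤ t.card := by
    refine Finset.card_le_card_of_injOn z (fun b _ => hzt b) fun b _ b' _ hbb => ?_
    by_contra hne
    obtain ⟨i, hi⟩ := Function.ne_iff.1 hne
    have h1 : dist (fun i => v (b i)) (fun i => v (b' i)) ≤ s / 2 / 2 + s / 2 / 2 := by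
      refine (dist_triangle_right _ _ (z b)).trans (add_le_add (hz b) ?_)
      rw [hbb]; exact hz b'
    have h2 := (dist_le_pi_dist (fun i => v (b i)) (fun i => v (b' i)) i).trans h1
    rw [hv' _ _ hi] at h2
    linarith
  simpa using hcard

lemma doublingDim_cube (n : ℕ) {s : ℝ} (hs : 0 < s) :
    doublingDim (Fin n → Set.Icc (0 : ℝ) s) = n := by
  have h : doublingConstant (Fin n → Set.Icc (0 : ℝ) s) = 2 ^ n :=
    le_antisymm (Nat.sInf_le (coversByHalves_cube n hs.le))
      (two_pow_le_of_coversByHalves_cube hs (Nat.sInf_mem (s := {N | CoversByHalves _ N})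
        ⟨_, coversByHalves_cube n hs.le⟩))
  rw [doublingDim, h, Nat.cast_pow, Nat.cast_ofNat, Real.logb_pow, Real.logb_self_eq_one one_lt_two,
    mul_one]

end Cube

/-! ### The two hard losses. -/

section Losses

variable {X : Type} [MetricSpace X]

/-- The loss `dist x o ^ q`, with a deeper minimum dug at `z`. -/
noncomputable def dugLoss (q : ℝ) (o z x : X) : ℝ :=
  open Classical in if dist x z < dist z o / 2 then dist x z ^ q - dist z o ^ q else dist x o ^ q

lemma one_le_rpow_self {q : ℝ} (hq : 1 ≤ q) : (1 : ℝ) ≤ 2 ^ q :=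
  Real.one_le_rpow one_le_two (by linarith)

lemma two_rpow_neg_le_one {q : ℝ} (hq : 1 ≤ q) : (2 : ℝ) ^ (-q) ≤ 1 :=
  Real.rpow_le_one_of_one_le_of_nonpos one_le_two (by linarith)

lemma two_rpow_neg_le_two_mul_three_rpow {q : ℝ} (hq : 1 ≤ q) : (2 : ℝ) ^ (-q) ≤ 2 * 3 ^ q := by
  have : (1 : ℝ) ≤ 3 ^ q := Real.one_le_rpow (by norm_num) (by linarith)
  linarith [two_rpow_neg_le_one hq]

lemma isNondegenerate_of_bounds {lam L q : ℝ} {f : X → ℝ} {o : X} (hlam : 0 < lam) (hL : lam ≤ L)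
    (hq : 1 ≤ q) (h : ∀ x, lam * dist x o ^ q ≤ f x - f o ∧ f x - f o ≤ L * dist x o ^ q) :
    IsNondegenerate lam L q f o := by
  refine ⟨hlam, hL, hq, fun x hx => ?_, h⟩
  have := mul_pos hlam (Real.rpow_pos_of_pos (dist_pos.2 hx) q)
  linarith [(h x).1]

lemma isNondegenerate_dist_rpow {q : ℝ} (hq : 1 ≤ q) (o : X) :
    IsNondegenerate (2 ^ (-q)) (2 * 3 ^ q) q (fun x => dist x o ^ q) o := by
  refine isNondegenerate_of_bounds (by positivity) (two_rpow_neg_le_two_mul_three_rpow hq) hq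
    fun x => ?_
  have h3 : (1 : ℝ) ≤ 3 ^ q := Real.one_le_rpow (by norm_num) (by linarith)
  have hd : 0 ≤ dist x o ^ q := by positivity
  rw [dist_self, Real.zero_rpow (by linarith), sub_zero]
  constructor
  · exact mul_le_of_le_one_left hd (two_rpow_neg_le_one hq)
  · exact le_mul_of_one_le_left hd (by linarith)

lemma dugLoss_self {q : ℝ} (hq : 1 ≤ q) {o z : X} (hz : z ≠ o) :
    dugLoss q o z z = -dist z o ^ q := by
  have := dist_pos.2 hz
  rw [dugLoss, if_pos (by rw [dist_self]; positivity), dist_self, Real.zero_rpow (by linarith),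
    zero_sub]

/-- Outside the hole, `dist x z` is at most twice the larger of `dist x o` and `dist z o`, whence `2
^ (-q)`. Conversely `dist z o ≤ 2 * dist x z` and `dist x o ≤ 3 * dist x z`, whence `2 ^ q + 3 ^ q ≤
2 * 3 ^ q`. -/
lemma isNondegenerate_dugLoss {q : ℝ} (hq : 1 ≤ q) {o z : X} (hz : z ≠ o) :
    IsNondegenerate (2 ^ (-q)) (2 * 3 ^ q) q (dugLoss q o z) z := by
  have hq0 : 0 ≤ q := by linarith
  refine isNondegenerate_of_bounds (by positivity) (two_rpow_neg_le_two_mul_three_rpow hq) hq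
    fun x => ?_
  have h3 : (1 : ℝ) ≤ 3 ^ q := Real.one_le_rpow (by norm_num) hq0
  have h23 : (2 : ℝ) ^ q ≤ 3 ^ q := Real.rpow_le_rpow (by norm_num) (by norm_num) hq0
  have hd : 0 ≤ dist x z ^ q := by positivity
  have hr := dist_pos.2 hz
  rw [dugLoss_self hq hz, dugLoss]
  split_ifs with h
  · rw [show dist x z ^ q - dist z o ^ q - -dist z o ^ q = dist x z ^ q by ring]
    constructor
    · exact mul_le_of_le_one_left hd (two_rpow_neg_le_one hq)
    · exact le_mul_of_one_le_left hd (by linarith)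
  · rw [not_lt] at h
    rw [sub_neg_eq_add]
    constructor
    · rw [Real.rpow_neg (by norm_num), inv_mul_le_iff₀ (by positivity)]
      have htri := dist_triangle_right x z o
      rcases le_total (dist x o) (dist z o) with hle | hle
      · calc dist x z ^ q ≤ (2 * dist z o) ^ q := by gcongr; linarith
          _ = 2 ^ q * dist z o ^ q := Real.mul_rpow (by norm_num) hr.le
          _ ≤ _ := by gcongr; linarith [Real.rpow_nonneg (dist_nonneg (x := x) (y := o)) q]
      · calc dist x z ^ q ≤ (2 * dist x o) ^ q := by gcongr; linarith
          _ = 2 ^ q * dist x o ^ q := Real.mul_rpow (by norm_num) dist_nonneg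
          _ ≤ _ := by gcongr; linarith [Real.rpow_nonneg hr.le q]
    · have h1 : dist x o ^ q ≤ 3 ^ q * dist x z ^ q := by
        rw [← Real.mul_rpow (by norm_num) dist_nonneg]
        gcongr
        linarith [dist_triangle x z o]
      have h2 : dist z o ^ q ≤ 2 ^ q * dist x z ^ q := by
        rw [← Real.mul_rpow (by norm_num) dist_nonneg]
        gcongr
        linarith
      nlinarith

lemma abs_dist_rpow_sub_dugLoss_le {q : ℝ} (hq : 1 ≤ q) (o z x : X) :
    |dist x o ^ q - dugLoss q o z x| ≤ 2 * 2 ^ q * dist z o ^ q := by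
  have hq0 : 0 ≤ q := by linarith
  rw [dugLoss]
  split_ifs with h
  · have h1 : dist x o ^ q ≤ 2 ^ q * dist z o ^ q := by
      rw [← Real.mul_rpow (by norm_num) dist_nonneg]
      gcongr
      linarith [dist_triangle x z o, dist_nonneg (x := z) (y := o)]
    have h2 : dist x z ^ q ≤ dist z o ^ q := by
      gcongr; linarith [dist_nonneg (x := z) (y := o)]
    have h3 : dist z o ^ q ≤ 2 ^ q * dist z o ^ q :=
      le_mul_of_one_le_left (by positivity) (one_le_rpow_self hq)
    have h4 : 0 ≤ dist x o ^ q := by positivity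
    have h5 : 0 ≤ dist x z ^ q := by positivity
    have h6 : 0 ≤ dist z o ^ q := by positivity
    rw [abs_le]; constructor <;> nlinarith
  · rw [sub_self, abs_zero]; positivity

/-- Inside the hole `x` is at least `dist z o / 2` from `o`. Outside it, the dug loss is nonnegative
while its minimum is `-dist z o ^ q`. -/
lemma le_regret_add_regret {q : ℝ} (hq : 1 ≤ q) {o z : X} (hz : z ≠ o) (x : X) :
    2 ^ (-q) * dist z o ^ q ≤
      (dist x o ^ q - dist o o ^ q) + (dugLoss q o z x - dugLoss q o z z) := by
  have hq0 : 0 ≤ q := by linarith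
  have hr := dist_pos.2 hz
  rw [dugLoss_self hq hz, dist_self, Real.zero_rpow (by linarith), sub_zero, dugLoss]
  split_ifs with h
  · have h1 : 2 ^ (-q) * dist z o ^ q ≤ dist x o ^ q := by
      rw [Real.rpow_neg (by norm_num), inv_mul_le_iff₀ (by positivity),
        ← Real.mul_rpow (by norm_num) dist_nonneg]
      gcongr
      have := dist_triangle_left z o x
      linarith
    have h2 : 0 ≤ dist x z ^ q := by positivity
    linarith
  · have h1 : 2 ^ (-q) * dist z o ^ q ≤ dist z o ^ q :=
      mul_le_of_le_one_left (by positivity) (two_rpow_neg_le_one hq)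
    have h2 : 0 ≤ dist x o ^ q := by positivity
    linarith

lemma measurable_dugLoss [MeasurableSpace X] [BorelSpace X] (q : ℝ) (o z : X) :
    Measurable (dugLoss q o z) := by
  unfold dugLoss
  refine Measurable.ite (measurableSet_lt (by fun_prop) measurable_const) ?_ ?_
  · fun_prop
  · fun_prop

/-- The instance with standard Gaussian noise and a given mean loss. -/
noncomputable def gaussianInstance [MeasurableSpace X] {lam L q : ℝ} {f : X → ℝ} {o : X}
    (h : IsNondegenerate lam L q f o) (hf : Measurable f) : Instance X lam L q where
  loss := f
  opt := o
  nondegenerate := h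
  measurable_loss := hf
  noise := gaussianReal 0 1
  isProbabilityMeasure_noise := inferInstance
  noise_mean := integral_id_gaussianReal
  noise_subgaussian :=
    { integrable_exp_mul := fun t => integrable_exp_mul_gaussianReal t
      mgf_le := fun t => by
        rw [mgf_fun_id_gaussianReal]
        simp }

end Losses

/-- The regret forced by a batch that starts after time `w ^ 2` and ends before time `R * w`. -/
lemma Policy.exists_regret_ge_of_longBatch {X : Type} [MetricSpace X] [MeasurableSpace X]
    [BorelSpace X] [CompactSpace X] {T M : ℕ} (π : Policy X T M) {q : ℝ} (hq : 1 ≤ q) {o z : X}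
    {w R p : ℝ} (hw : 0 < w) (hp : 0 ≤ p)
    (hz : dist z o ^ q = (2 * 2 ^ q * w)⁻¹) {j : ℕ} (hj : j < M) (hT : R * w ≤ T)
    (hlong : p ≤ π.gaussianLaw.real {v : π.Seed × (ℕ → ℝ) |
      (v.1, π.losses (fun x => dist x o ^ q) v.1 v.2 ⌊w ^ 2⌋₊) ∈
        π.longBatch j ⌊w ^ 2⌋₊ ⌈R * w⌉₊}) :
    ∃ I : Instance X (2 ^ (-q)) (2 * 3 ^ q) q,
      R * p ^ 2 / (48 * 4 ^ q) ≤ π.expectedRegret I := by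
  have hzo : z ≠ o := by
    rintro rfl
    rw [dist_self, Real.zero_rpow (by linarith)] at hz
    exact absurd hz (by positivity)
  have hmeas : Measurable fun x : X => dist x o ^ q := by fun_prop
  obtain ⟨I, hI⟩ := π.two_point_bound
    (gaussianInstance (isNondegenerate_dist_rpow hq o) hmeas)
    (gaussianInstance (isNondegenerate_dugLoss hq hzo) (measurable_dugLoss q o z)) rfl rfl
    (δ := 2 * 2 ^ q * dist z o ^ q) (g := 2 ^ (-q) * dist z o ^ q) (by positivity) hp
    (abs_dist_rpow_sub_dugLoss_le hq o z) (le_regret_add_regret hq hzo) hj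
    (Nat.ceil_le.2 hT) hlong
  refine ⟨I, le_trans ?_ hI⟩
  -- This is why `hz` has its form: over `w ^ 2` losses the change of measure costs only `exp (-1)`,
  -- at least `1 / 3`.
  have hδ : 2 * 2 ^ q * dist z o ^ q = w⁻¹ := by
    rw [hz]; field_simp
  have h4 : (4 : ℝ) ^ q = 2 ^ q * 2 ^ q := by
    rw [← Real.mul_rpow (by norm_num) (by norm_num)]; norm_num
  have hg : 2 ^ (-q) * dist z o ^ q = (2 * 4 ^ q * w)⁻¹ := by
    rw [hz, Real.rpow_neg (by norm_num), h4, ← mul_inv]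
    congr 1; ring
  have hfl : ((⌊w ^ 2⌋₊ : ℕ) : ℝ) ≤ w ^ 2 := Nat.floor_le (by positivity)
  have hexp : (1 / 3 : ℝ) ≤ Real.exp (-((⌊w ^ 2⌋₊ : ℕ) * (2 * 2 ^ q * dist z o ^ q) ^ 2)) := by
    have h1 : ((⌊w ^ 2⌋₊ : ℕ) : ℝ) * (2 * 2 ^ q * dist z o ^ q) ^ 2 ≤ 1 := by
      rw [hδ, inv_pow, mul_inv_le_iff₀ (by positivity), one_mul]; exact hfl
    have h2 : (1 / 3 : ℝ) ≤ Real.exp (-1) := by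
      rw [Real.exp_neg, one_div]
      exact inv_anti₀ (Real.exp_pos _) (by linarith [Real.exp_one_lt_d9])
    exact h2.trans (Real.exp_le_exp.2 (by linarith))
  have hN : R / (4 * 4 ^ q) ≤ (⌈R * w⌉₊ : ℕ) * (2 ^ (-q) * dist z o ^ q) / 2 := by
    rw [hg]
    calc R / (4 * 4 ^ q) = (R * w) * (2 * 4 ^ q * w)⁻¹ / 2 := by field_simp; norm_num
      _ ≤ _ := by gcongr; exact Nat.le_ceil _
  calc R * p ^ 2 / (48 * 4 ^ q) = R / (4 * 4 ^ q) * ((p / 2) ^ 2 * (1 / 3)) := by field_simp; ring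
    _ ≤ _ := by gcongr

end BatchedBandit

/-! ### Choice of scales, and the theorem. -/

namespace BatchedBandit

lemma eventually_const_add_log_log_le (K : ℝ) :
    ∀ᶠ T : ℕ in Filter.atTop, 1 ≤ Real.log T ∧
      K + Real.log (Real.log T) ≤ √(Real.log T) / 4 := by
  have hlog : Filter.Tendsto (fun T : ℕ => Real.log T) Filter.atTop Filter.atTop :=
    Real.tendsto_log_atTop.comp tendsto_natCast_atTop_atTop
  refine hlog.eventually (p := fun l => 1 ≤ l ∧ K + Real.log l ≤ √l / 4) ?_
  have h1 : ∀ᶠ l : ℝ in Filter.atTop, Real.log l ≤ 1 / 8 * l ^ (1 / 2 : ℝ) := by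
    filter_upwards [(isLittleO_log_rpow_atTop (r := 1 / 2) (by norm_num)).bound
      (c := 1 / 8) (by norm_num), Filter.eventually_ge_atTop 1] with l hl hl1
    rw [Real.norm_eq_abs, Real.norm_eq_abs, abs_of_nonneg (Real.log_nonneg hl1),
      abs_of_nonneg (by positivity)] at hl
    exact hl
  filter_upwards [h1, Filter.eventually_ge_atTop 1, Filter.eventually_ge_atTop ((8 * |K|) ^ 2)]
    with l hl hl1 hlK
  rw [← Real.sqrt_eq_rpow] at hl
  have : 8 * |K| ≤ √l := Real.le_sqrt_of_sq_le hlK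
  exact ⟨hl1, by linarith [le_abs_self K]⟩

/-- Since `2 ≤ e`, the constant `c = 1 / 2` already suffices. -/
lemma two_pow_le_sqrt_of_lt_half_log {M : ℕ} {l : ℝ} (hl : 0 < l) (hM : M < 1 / 2 * Real.log l) :
    (2 : ℝ) ^ M ≤ √l := by
  calc (2 : ℝ) ^ M ≤ Real.exp 1 ^ M := by gcongr; linarith [Real.exp_one_gt_d9]
    _ = Real.exp M := by rw [← Real.exp_nat_mul, mul_one]
    _ ≤ Real.exp (Real.log l * (1 / 2)) := Real.exp_le_exp.2 (by linarith)
    _ = √l := by rw [Real.sqrt_eq_rpow, Real.rpow_def_of_pos hl]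

/-- With fewer than `log (log T) / 2` rounds, the tower `B ^ 2 ^ M` is dominated. -/
lemma tower_le {q D : ℝ} (hq : 1 ≤ q) (hD : 1 ≤ D) {T M n : ℕ} (hM0 : 0 < M)
    (hl : 1 ≤ Real.log T) (hK : Real.log D + Real.log (Real.log T) ≤ √(Real.log T) / 4)
    (hM : M < 1 / 2 * Real.log (Real.log T)) :
    (D * M ^ 2 * 2 ^ n) ^ 2 ^ M ≤ √T * Real.exp (n ^ 2) ^ q := by
  set l := Real.log T with hl_def
  have hT : (0 : ℝ) < T := by
    rcases Nat.eq_zero_or_pos T with rfl | h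
    · simp [hl_def] at hl; linarith
    · exact_mod_cast h
  have h2M := two_pow_le_sqrt_of_lt_half_log (by linarith) hM
  have hMl : (M : ℝ) ^ 2 ≤ l := by
    have h1 : (M : ℝ) ≤ √l := le_trans (by exact_mod_cast Nat.lt_two_pow_self.le) h2M
    calc (M : ℝ) ^ 2 ≤ √l ^ 2 := by gcongr
      _ = l := Real.sq_sqrt (by linarith)
  have hM1 : (0 : ℝ) < M := by exact_mod_cast hM0
  have hlogB : Real.log (D * M ^ 2 * 2 ^ n) ≤ √l / 4 + n := by
    rw [Real.log_mul (by positivity) (by positivity), Real.log_mul (by positivity) (by positivity),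
      Real.log_pow (2 : ℝ) n]
    have h1 : Real.log ((M : ℝ) ^ 2) ≤ Real.log l := Real.log_le_log (by positivity) hMl
    have h2 : (n : ℝ) * Real.log 2 ≤ n :=
      mul_le_of_le_one_right (by positivity) (by linarith [Real.log_two_lt_d9])
    linarith
  rw [← Real.log_le_log_iff (by positivity) (by positivity), Real.log_pow,
    Real.log_mul (x := √(T : ℝ)) (by positivity) (by positivity), Real.log_sqrt hT.le,
    Real.log_rpow (Real.exp_pos _), Real.log_exp]
  have hsq : √l * √l = l := Real.mul_self_sqrt (by linarith)
  have hs := Real.sqrt_nonneg l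
  calc ((2 ^ M : ℕ) : ℝ) * Real.log (D * M ^ 2 * 2 ^ n)
      ≤ √l * (√l / 4 + n) := by
        push_cast
        exact mul_le_mul h2M hlogB (Real.log_nonneg
          (one_le_mul_of_one_le_of_one_le (one_le_mul_of_one_le_of_one_le hD
            (one_le_pow₀ (by exact_mod_cast hM0))) (one_le_pow₀ one_le_two))) hs
    _ ≤ l / 2 + 1 * (n : ℝ) ^ 2 := by nlinarith [sq_nonneg (√l / 2 - n)]
    _ ≤ l / 2 + q * (n : ℝ) ^ 2 := by gcongr

lemma Policy.rounds_pos {X : Type} [MeasurableSpace X] {T M : ℕ} (π : Policy X T M) (hT : 0 < T) :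
    0 < M := by
  obtain ⟨u⟩ := π.seedLaw.nonempty_of_neZero
  by_contra h
  obtain rfl : M = 0 := by omega
  have h1 := π.grid_zero u 0
  rw [π.grid_last u 0] at h1
  omega

/-- The lower bound for `M` rounds on a cube large enough to contain the hard instances at the
coarsest scale. -/
lemma Policy.exists_regret_ge_cube {n T M : ℕ} (hn : 0 < n) (hT : 0 < T) {s q B : ℝ} (hs : 0 ≤ s)
    (hq : 1 ≤ q) (hB : 1 ≤ B) (hBs : B ^ 2 ^ M ≤ √T * s ^ q)
    (π : Policy (Fin n → Set.Icc (0 : ℝ) s) T M) :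
    ∃ I : Instance (Fin n → Set.Icc (0 : ℝ) s) (2 ^ (-q)) (2 * 3 ^ q) q,
      B * √T * (1 / (M : ℝ)) ^ 2 / (48 * 4 ^ q) ≤ π.expectedRegret I := by
  have hT' : (0 : ℝ) < T := by exact_mod_cast hT
  have hB0 : 0 < B := by linarith
  -- The solution of `w (j + 1) ^ 2 = B * √T * w j` with `w M = √T`.
  set w : ℕ → ℝ := fun j => √T * B / B ^ 2 ^ (M - j) with hw_def
  have hw : ∀ j, 0 < w j := fun j => by positivity
  have hwM : w M ^ 2 = T := by
    simp only [hw_def, Nat.sub_self, pow_zero, pow_one]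
    rw [mul_div_cancel_right₀ _ hB0.ne', Real.sq_sqrt hT'.le]
  have hwT : ∀ j, w j ^ 2 ≤ T := fun j => by
    rw [← Real.sq_sqrt hT'.le]
    have : w j ≤ √T := by
      rw [hw_def, div_le_iff₀ (by positivity)]
      gcongr
      exact le_self_pow₀ hB (by positivity)
    gcongr
  have hsucc : ∀ j < M, w (j + 1) ^ 2 = B * √T * w j := fun j hj => by
    have h1 : M - j = (M - (j + 1)) + 1 := by omega
    simp only [hw_def]
    rw [h1, pow_succ 2, pow_mul]
    field_simp
  let o : Fin n → Set.Icc (0 : ℝ) s := fun _ => ⟨0, le_rfl, hs⟩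
  obtain ⟨j, hj, hlong⟩ := π.exists_longBatch_prob (f := fun x => dist x o ^ q)
    (θ := fun j => w j ^ 2) (pow_pos (hw 0) 2) hwM (fun j _ => hwT j)
  simp only [hsucc j hj] at hlong
  have hle : (2 * 2 ^ q * w j)⁻¹ ≤ s ^ q := by
    rw [inv_le_comm₀ (by have := hw j; positivity)
      -- Only `0 ≤ s` is assumed; `hBs` forces `s ^ q > 0`, as its left side is positive.
      (lt_of_not_ge fun h => by
        have := mul_nonpos_of_nonneg_of_nonpos (Real.sqrt_nonneg T) h
        linarith [pow_pos hB0 (2 ^ M)])]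
    have h1 : (s ^ q)⁻¹ ≤ w j := by
      have hpow : B ^ 2 ^ (M - j) ≤ B ^ 2 ^ M := by
        gcongr
        · exact one_le_two
        · exact Nat.sub_le _ _
      rw [hw_def, le_div_iff₀ (by positivity)]
      calc (s ^ q)⁻¹ * B ^ 2 ^ (M - j) ≤ (s ^ q)⁻¹ * (√T * s ^ q) := by
            gcongr; exact hpow.trans hBs
        _ = √T * ((s ^ q)⁻¹ * s ^ q) := by ring
        _ ≤ √T * 1 := by gcongr; exact inv_mul_le_one
        _ ≤ √T * B := by gcongr
    refine h1.trans (le_mul_of_one_le_left (hw j).le ?_)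
    linarith [one_le_rpow_self hq]
  set r : ℝ := ((2 * 2 ^ q * w j)⁻¹) ^ q⁻¹ with hr_def
  have hwj := hw j
  have hr : 0 ≤ r := by positivity
  have hrq : r ^ q = (2 * 2 ^ q * w j)⁻¹ := Real.rpow_inv_rpow (by positivity) (by linarith)
  have hrs : r ≤ s := by
    rwa [← hrq, Real.rpow_le_rpow_iff hr hs (by linarith)] at hle
  have : Nonempty (Fin n) := ⟨⟨0, hn⟩⟩
  let z : Fin n → Set.Icc (0 : ℝ) s := fun _ => ⟨r, hr, hrs⟩
  have hz : dist z o = r := by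
    rw [dist_pi_const, Subtype.dist_eq, Real.dist_eq, sub_zero, abs_of_nonneg hr]
  exact π.exists_regret_ge_of_longBatch hq (z := z) hwj (by positivity)
    (by rw [hz, hrq]) hj (by rw [← hsucc j hj]; exact hwT _) hlong

end BatchedBandit

theorem corollary3 :
    ∃ A : ℝ, 1 < A ∧ ∃ c : ℝ, 0 < c ∧
    ∀ q : ℝ, 1 ≤ q →
    ∃ lam L : ℝ, 0 < lam ∧ lam ≤ L ∧
    ∃ T₀ : ℝ → ℕ,
    ∀ d : ℝ, 1 ≤ d →
    ∃ (X : Type) (_ : MetricSpace X) (_ : MeasurableSpace X) (_ : BorelSpace X),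
      CompactSpace X ∧ BatchedBandit.IsDoubling X ∧ BatchedBandit.doublingDim X = (⌊d⌋₊ : ℝ) ∧
      ∀ C : ℝ, 0 < C → ∀ T : ℕ, T₀ C ≤ T →
      ∀ M : ℕ, (M : ℝ) < c * Real.log (Real.log (T : ℝ)) →
      ∀ π : BatchedBandit.Policy X T M, ∃ I : BatchedBandit.Instance X lam L q,
        C * A ^ ⌊d⌋₊ * Real.sqrt (T : ℝ) < π.expectedRegret I := by
  refine ⟨2, one_lt_two, 1 / 2, by norm_num, fun q hq => ⟨2 ^ (-q), 2 * 3 ^ q, by positivity,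
    BatchedBandit.two_rpow_neg_le_two_mul_three_rpow hq, ?_⟩⟩
  choose T₀ hT₀ using fun C : ℝ => Filter.eventually_atTop.1
    (BatchedBandit.eventually_const_add_log_log_le (Real.log (48 * 4 ^ q * (C + 1))))
  refine ⟨T₀, fun d hd => ?_⟩
  have hn : 0 < ⌊d⌋₊ := Nat.floor_pos.2 hd
  generalize ⌊d⌋₊ = n at hn
  have hs : 0 < Real.exp ((n : ℝ) ^ 2) := Real.exp_pos _
  refine ⟨Fin n → Set.Icc (0 : ℝ) (Real.exp ((n : ℝ) ^ 2)), inferInstance, inferInstance,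
    inferInstance, inferInstance, ⟨_, BatchedBandit.coversByHalves_cube n hs.le⟩,
    BatchedBandit.doublingDim_cube n hs, fun C hC T hT M hM π => ?_⟩
  obtain ⟨hl, hK⟩ := hT₀ C T hT
  have hTpos : 0 < T := Nat.pos_of_ne_zero fun h => by subst h; norm_num at hl
  have hM0 : 0 < M := π.rounds_pos hTpos
  have hD : (1 : ℝ) ≤ 48 * 4 ^ q * (C + 1) := by
    have h4 : (1 : ℝ) ≤ 4 ^ q := Real.one_le_rpow (by norm_num) (by linarith)
    nlinarith
  have hM1 : (1 : ℝ) ≤ M := by exact_mod_cast hM0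
  -- Here `B = 48 * 4 ^ q * (C + 1) * M ^ 2 * 2 ^ n`, which cancels the losses `48 * 4 ^ q` and `M ^
  -- 2` of the bound; `C + 1` makes the inequality strict.
  obtain ⟨I, hI⟩ := π.exists_regret_ge_cube hn hTpos hs.le hq
    (one_le_mul_of_one_le_of_one_le (one_le_mul_of_one_le_of_one_le hD (one_le_pow₀ hM1))
      (one_le_pow₀ one_le_two)) (BatchedBandit.tower_le hq hD hM0 hl hK hM)
  refine ⟨I, lt_of_lt_of_le ?_ hI⟩
  have hT' : 0 < √(T : ℝ) := Real.sqrt_pos.2 (by exact_mod_cast hTpos)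
  calc C * 2 ^ n * √(T : ℝ) < (C + 1) * 2 ^ n * √(T : ℝ) := by gcongr; linarith
    _ = _ := by field_simp
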